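/- Let $\mathbb F_q$ be the finite field with $q$ elements and let $$f(x)=\frac{1+x+x^2+\cdots+x^{q-1}}{x^{(q-1)/3}}\qquad(x>0).$$ Then there is a real number $r$ with $0<r<1$ at which $f$ attains its minimum over the positive real axis. For every such $r$, put $\theta_q=f(r)=\min_{x>0}f(x)$. Then $f''(r)>0$, $\theta_q<q$, and the following holds. For a positive integer $n$ and $\alpha,\beta,\gamma\in\mathbb F_q$ with $\alpha+\beta+\gamma=0$ and $\gamma\neq0$, let $A\subseteq\mathbb F_q^n$ be any set such that all solutions $(a_1,a_2,a_3)\in A^3$ of $$\alpha a_1+\beta a_2+\gamma a_3=0$$ satisfy $a_1=a_2=a_3$. Then, as $n\to\infty$ with $q$ fixed, $$|A|\le \frac{3}{(1-r)r}\sqrt{\frac{f(r)}{f''(r)}}\,\frac{f(r)^n}{\sqrt{2\pi n}}\,(1+o(1)),$$ where the $o(1)$ term depends only on $q$, $r$ and $n$ (not on $A,\alpha,\beta,\gamma$). In particular $|A|=O\!\left(\theta_q^{\,n}/\sqrt n\right)$, with an implied constant not depending on $n$, $A$, $\alpha$, $\beta$, $\gamma$; that is, there is a constant $C$ with $|A|\le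 C\,\theta_q^{\,n}/\sqrt n$ for all $n\ge1$ and all such $\alpha,\beta,\gamma,A$. -/

import Mathlib

open Set Filter Topology

/-- The function `f(x) = (1 + x + ⋯ + x^(q-1)) / x^((q-1)/3)`; the exponent `(q-1)/3` is real. -/
noncomputable def ratioFun (q : ℕ) (x : ℝ) : ℝ :=
  (∑ i ∈ Finset.range q, x ^ i) / x ^ (((q : ℝ) - 1) / 3)

/-- Every solution `(a₁, a₂, a₃) ∈ A³` of `α a₁ + β a₂ + γ a₃ = 0` satisfies `a₁ = a₂ = a₃`. -/
def OnlyTrivialSolutions {F : Type*} [Field F] {n : ℕ} (α β γ : F)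
    (A : Finset (Fin n → F)) : Prop :=
  ∀ a₁ ∈ A, ∀ a₂ ∈ A, ∀ a₃ ∈ A, α • a₁ + β • a₂ + γ • a₃ = 0 → a₁ = a₂ ∧ a₂ = a₃

/-! By the slice-rank polynomial method, on A³ the indicator of α a₁ + β a₂ + γ a₃ = 0 is the
diagonal tensor, of slice rank |A|. Expanded coordinatewise by Fermat's little theorem, it is a
combination of products of three monomials of total degree at most (q-1)n, so one factor has degree
at most (q-1)n/3. Grouping by that factor gives |A| ≤ 3M, with M the number of such exponent vectors
(`card_le_three_mul_card_lowDegreeExponents`).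

To estimate M, let P(x) = 1 + x + ⋯ + x^(q-1). The number of vectors of degree k is a Fourier
coefficient of P(r e^{it})^n divided by r^k. Bounding it by the integral of the modulus and summing
over k gives f(r)^n / (2π(1-r)) times an integral depending only on q, r, n
(`card_lowDegreeExponents_le`). Laplace's method makes that integral asymptotic to √(2π / (σ² n)),
where σ² is the variance of the law with weights r^j. The critical equation f'(r) = 0 says that this
law has mean (q-1)/3, whence σ² = r² f''(r) / f(r) (`sq_mul_deriv_deriv_ratioFun`). -/

/-! ### Slice rank of the diagonal tensor -/

/-- A subspace of `ι → K` of dimension at least `d` has a vector whose support has at least `d` elements. -/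
theorem exists_mem_le_card_support {K ι : Type*} [Field K] [Fintype ι]
    (W : Submodule K (ι → K)) :
    ∃ u ∈ W, Module.finrank K W ≤ {i | u i ≠ 0}.ncard := by
  classical
  -- Take u of maximal support S. If |S| < dim W, some nonzero w in W vanishes on S, and u + w has
  -- strictly larger support.
  obtain ⟨u, hu⟩ := exists_max_image (univ.image fun u : W => {i | (u : ι → K) i ≠ 0}) Set.ncard
    (Set.toFinite _) ⟨_, ⟨0, trivial, rfl⟩⟩
  obtain ⟨⟨⟨u, huW⟩, -, rfl⟩, hmax⟩ := hu
  refine ⟨u, huW, ?_⟩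
  by_contra! hlt
  set S : Set ι := {i | u i ≠ 0} with hS
  let φ : W →ₗ[K] (S → K) := (LinearMap.funLeft K K (fun i : S => (i : ι))).comp W.subtype
  have hφ : ¬ Function.Injective φ := by
    intro h
    have := LinearMap.finrank_le_finrank_of_injective h
    rw [Module.finrank_fintype_fun_eq_card, ← Nat.card_eq_fintype_card, Nat.card_coe_set_eq] at this
    exact absurd this (not_le.2 hlt)
  obtain ⟨w, hw, hw0⟩ : ∃ w, φ w = 0 ∧ w ≠ 0 := by
    by_contra! h
    exact hφ ((injective_iff_map_eq_zero φ).2 h)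
  have hwS : ∀ i ∈ S, (w : ι → K) i = 0 := fun i hi => congr_fun hw ⟨i, hi⟩
  obtain ⟨j, hj⟩ : ∃ j, (w : ι → K) j ≠ 0 := by
    by_contra! h
    exact hw0 (Subtype.ext (funext h))
  have hjS : j ∉ S := fun h => hj (hwS j h)
  have hle := hmax _ ⟨⟨u, huW⟩ + w, trivial, rfl⟩
  have hsub : insert j S ⊆ {i | ((⟨u, huW⟩ + w : W) : ι → K) i ≠ 0} := by
    intro i hi
    rcases hi with rfl | hi
    · have : u i = 0 := by simpa [hS] using hjS
      simpa [this] using hj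
    · have : u i ≠ 0 := hi
      simpa [hwS i hi] using this
  have := Set.ncard_le_ncard hsub (Set.toFinite _)
  rw [Set.ncard_insert_of_notMem hjS (Set.toFinite _)] at this
  simp only [hS] at this hle
  omega

/-- The diagonal tensor on `ι³` has slice rank `|ι|`: it is not a sum of fewer slices. -/
theorem card_le_of_diagonal_eq_sum_slices {K ι M₁ M₂ M₃ : Type*} [Field K] [Fintype ι]
    [DecidableEq ι] [Fintype M₁] [Fintype M₂] [Fintype M₃]
    (f₁ : M₁ → ι → K) (g₁ : M₁ → ι → ι → K) (f₂ : M₂ → ι → K) (g₂ : M₂ → ι → ι → K)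
    (f₃ : M₃ → ι → K) (g₃ : M₃ → ι → ι → K)
    (h : ∀ a b c, (if a = b ∧ b = c then (1 : K) else 0) =
      ∑ m, f₁ m a * g₁ m b c + ∑ m, f₂ m b * g₂ m a c + ∑ m, f₃ m c * g₃ m a b) :
    Fintype.card ι ≤ Fintype.card M₁ + Fintype.card M₂ + Fintype.card M₃ := by
  classical
  -- Contracting the first index with a vector u orthogonal to every f₁ m kills the first family of
  -- slices. What remains is `Matrix.diagonal u`, of rank at most |M₂| + |M₃|, while u can be chosen
  -- with at least |ι| - |M₁| nonzero entries.
  let φ : (ι → K) →ₗ[K] (M₁ → K) := Matrix.mulVecLin (Matrix.of f₁)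
  obtain ⟨u, hu, hcard⟩ := exists_mem_le_card_support (LinearMap.ker φ)
  have hdim := φ.finrank_range_add_finrank_ker
  have hrange := (LinearMap.range φ).finrank_le
  simp only [Module.finrank_fintype_fun_eq_card] at hdim hrange
  have hu0 : ∀ m, ∑ a, f₁ m a * u a = 0 := fun m => congr_fun hu m
  have hD : Matrix.diagonal u =
      (Matrix.of fun b m => f₂ m b) * (Matrix.of fun m c => ∑ a, u a * g₂ m a c) +
      (Matrix.of fun b m => ∑ a, u a * g₃ m a b) * (Matrix.of fun m c => f₃ m c) := by
    ext b c
    have h1 : ∑ a, u a * (if a = b ∧ b = c then (1 : K) else 0) = Matrix.diagonal u b c := by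
      by_cases hbc : b = c <;> simp [hbc]
    rw [← h1]
    simp only [h, mul_add, Finset.sum_add_distrib, Matrix.add_apply, Matrix.mul_apply,
      Matrix.of_apply, Finset.mul_sum, Finset.sum_mul]
    have h2 : ∑ a, ∑ m, u a * (f₁ m a * g₁ m b c) = 0 := by
      rw [Finset.sum_comm]
      refine Finset.sum_eq_zero fun m _ => ?_
      have : ∑ a, u a * (f₁ m a * g₁ m b c) = (∑ a, f₁ m a * u a) * g₁ m b c := by
        rw [Finset.sum_mul]; exact Finset.sum_congr rfl fun a _ => by ring
      rw [this, hu0, zero_mul]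
    rw [h2, zero_add]
    congr 1
    · rw [Finset.sum_comm]
      exact Finset.sum_congr rfl fun m _ => Finset.sum_congr rfl fun a _ => by ring
    · rw [Finset.sum_comm]
      exact Finset.sum_congr rfl fun m _ => Finset.sum_congr rfl fun a _ => by ring
  have hrank : (Matrix.diagonal u).rank ≤ Fintype.card M₂ + Fintype.card M₃ := by
    rw [hD, ← Matrix.fromCols_mul_fromRows]
    refine (Matrix.rank_mul_le_left _ _).trans ((Matrix.rank_le_card_width _).trans ?_)
    rw [Fintype.card_sum]
  rw [Matrix.rank_diagonal, ← Nat.card_eq_fintype_card] at hrank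
  have : Nat.card {i // u i ≠ 0} = {i | u i ≠ 0}.ncard := Nat.card_coe_set_eq _
  omega

/-! ### Polynomial method -/

/-- Exponent vectors in `{0, …, q-1}ⁿ` of degree at most `(q-1)n/3`. -/
def lowDegreeExponents (q n : ℕ) : Finset (Fin n → ℕ) :=
  {m ∈ Fintype.piFinset fun _ => Finset.range q | 3 * ∑ i, m i ≤ (q - 1) * n}

/-- The indicator function of the hyperplane `∑ c j * x j = 0` over a finite field, as a combination
of monomials of degree less than the cardinality of the field. -/
theorem exists_indicator_eq_sum_monomials {F : Type*} [Field F] [Fintype F] [DecidableEq F]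
    (c : Fin 3 → F) :
    ∃ (T : Finset (Fin 3 → ℕ)) (d : (Fin 3 → ℕ) → F),
      (∀ k ∈ T, ∑ j, k j ≤ Fintype.card F - 1) ∧
      ∀ x : Fin 3 → F, (if ∑ j, c j * x j = 0 then (1 : F) else 0) =
        ∑ k ∈ T, d k * ∏ j, x j ^ k j := by
  classical
  set q := Fintype.card F with hq
  have hq2 : 1 < q := Fintype.one_lt_card
  have h0 : (0 : Fin 3 → ℕ) ∉ Finset.piAntidiag Finset.univ (q - 1) := by
    simp [Finset.mem_piAntidiag]; omega
  -- Multinomial expansion of 1 - (∑ c j * x j)^(q-1). The exponent 0 carries the constant 1 and is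
  -- separate from the degree q-1 terms because q ≥ 2.
  refine ⟨insert 0 (Finset.piAntidiag Finset.univ (q - 1)),
    fun k => if k = 0 then 1 else -((Nat.multinomial Finset.univ k : F) * ∏ j, c j ^ k j), ?_, ?_⟩
  · intro k hk
    rcases Finset.mem_insert.1 hk with rfl | hk
    · simp
    · exact (Finset.mem_piAntidiag.1 hk).1.le
  · intro x
    rw [Finset.sum_insert h0]
    have h1 : (if ∑ j, c j * x j = 0 then (1 : F) else 0) = 1 - (∑ j, c j * x j) ^ (q - 1) := by
      split_ifs with h
      · rw [h, zero_pow (by omega), sub_zero]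
      · rw [FiniteField.pow_card_sub_one_eq_one _ h, sub_self]
    rw [h1, Finset.sum_pow_eq_sum_piAntidiag, sub_eq_add_neg, ← Finset.sum_neg_distrib]
    congr 1
    · simp
    · refine Finset.sum_congr rfl fun k hk => ?_
      have hk0 : k ≠ 0 := by rintro rfl; exact h0 hk
      simp only [if_neg hk0]
      rw [Finset.prod_congr rfl fun i _ => mul_pow (c i) (x i) (k i), Finset.prod_mul_distrib]
      ring

/-- Each term of the expanded indicator is assigned to a variable in which its degree is at most a
third of the total; terms sharing that variable and its monomial form one slice. -/
theorem card_le_three_mul_card_lowDegreeExponents {F : Type*} [Field F] [Fintype F] {n : ℕ}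
    {α β γ : F} (hsum : α + β + γ = 0) {A : Finset (Fin n → F)}
    (hA : OnlyTrivialSolutions α β γ A) :
    A.card ≤ 3 * (lowDegreeExponents (Fintype.card F) n).card := by
  classical
  set q := Fintype.card F with hq
  have hq2 : 1 < q := Fintype.one_lt_card
  obtain ⟨T, d, hT, hd⟩ := exists_indicator_eq_sum_monomials ![α, β, γ]
  set M := lowDegreeExponents q n
  let P : Finset (Fin n → Fin 3 → ℕ) := Fintype.piFinset fun _ => T
  have hP : ∀ t ∈ P, ∃ j, (fun i => t i j) ∈ M := by
    intro t ht
    have ht' : ∀ i, ∑ j, t i j ≤ q - 1 := fun i => hT _ (Fintype.mem_piFinset.1 ht i)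
    have htot : ∑ j, ∑ i, t i j ≤ (q - 1) * n := by
      rw [Finset.sum_comm]
      refine (Finset.sum_le_card_nsmul _ _ (q - 1) fun i _ => ht' i).trans ?_
      simp [mul_comm]
    have : ∃ j, 3 * ∑ i, t i j ≤ (q - 1) * n := by
      by_contra! hcon
      have h0 := hcon 0
      have h1 := hcon 1
      have h2 := hcon 2
      rw [Fin.sum_univ_three] at htot
      omega
    obtain ⟨j, hj⟩ := this
    refine ⟨j, Finset.mem_filter.2 ⟨Fintype.mem_piFinset.2 fun i => ?_, hj⟩⟩
    have := Finset.single_le_sum (f := fun j => t i j) (fun _ _ => Nat.zero_le _)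
      (Finset.mem_univ j)
    have := ht' i
    simp only [Finset.mem_range]
    omega
  choose! J hJ using hP
  let mono : (Fin n → ℕ) → (Fin n → F) → F := fun m a => ∏ i, a i ^ m i
  have key : ∀ x : Fin 3 → Fin n → F,
      (if α • x 0 + β • x 1 + γ • x 2 = 0 then (1 : F) else 0) =
        ∑ t ∈ P, (∏ i, d (t i)) * ∏ j, mono (fun i => t i j) (x j) := by
    intro x
    have h1 : (if α • x 0 + β • x 1 + γ • x 2 = 0 then (1 : F) else 0) =
        ∏ i, if ∑ j, ![α, β, γ] j * x j i = 0 then (1 : F) else 0 := by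
      rw [Finset.prod_ite_zero]
      simp [funext_iff, Fin.sum_univ_three]
    rw [h1]
    simp only [hd, Finset.prod_univ_sum]
    refine Finset.sum_congr rfl fun t _ => ?_
    rw [Finset.prod_mul_distrib, Finset.prod_comm]
  have split : ∀ (j : Fin 3) (G : (Fin n → Fin 3 → ℕ) → F) (a : Fin n → F),
      ∑ t ∈ P with J t = j, mono (fun i => t i j) a * G t =
        ∑ m : M, mono m a * ∑ t ∈ P with J t = j ∧ (fun i => t i j) = m, G t := by
    intro j G a
    rw [Finset.sum_coe_sort M
      (fun m => mono m a * ∑ t ∈ P with J t = j ∧ (fun i => t i j) = m, G t)]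
    rw [← Finset.sum_fiberwise_of_maps_to (t := M) (g := fun t => fun i => t i j)]
    · refine Finset.sum_congr rfl fun m _ => ?_
      rw [Finset.filter_filter, Finset.mul_sum]
      refine Finset.sum_congr rfl fun t ht => ?_
      rw [(Finset.mem_filter.1 ht).2.2]
    · intro t ht
      obtain ⟨htP, rfl⟩ := Finset.mem_filter.1 ht
      exact hJ t htP
  -- The remaining two variables are taken in cyclic order j + 1, j + 2 modulo 3, hence the swapped
  -- arguments for j = 1 below.
  let g : Fin 3 → M → (Fin n → F) → (Fin n → F) → F := fun j m b c =>
    ∑ t ∈ P with J t = j ∧ (fun i => t i j) = m,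
      (∏ i, d (t i)) * (mono (fun i => t i (j + 1)) b * mono (fun i => t i (j + 2)) c)
  have := card_le_of_diagonal_eq_sum_slices (ι := A) (M₁ := M) (M₂ := M) (M₃ := M)
    (fun m a => mono m a) (fun m b c => g 0 m b c)
    (fun m b => mono m b) (fun m a c => g 1 m c a)
    (fun m c => mono m c) (fun m a b => g 2 m a b) ?_
  · simp only [Fintype.card_coe] at this
    omega
  · intro a b c
    simp only [g, ← split]
    have h1 : (if a = b ∧ b = c then (1 : F) else 0) =
        if α • (a : Fin n → F) + β • (b : Fin n → F) + γ • (c : Fin n → F) = 0 then 1 else 0 := by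
      refine if_congr ⟨?_, fun h => ?_⟩ rfl rfl
      · rintro ⟨rfl, rfl⟩
        rw [← add_smul, ← add_smul, hsum, zero_smul]
      · have := hA a a.2 b b.2 c c.2 h
        exact ⟨Subtype.ext this.1, Subtype.ext this.2⟩
    have h2 := key ![a, b, c]
    simp only [Matrix.cons_val_zero, Matrix.cons_val_one, Matrix.cons_val] at h2
    rw [h1]
    refine h2.trans ?_
    rw [← Finset.sum_fiberwise (s := P) (g := J), Fin.sum_univ_three]
    simp only [Fin.prod_univ_three, Matrix.cons_val_zero, Matrix.cons_val_one, Matrix.cons_val]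
    congr 1
    · congr 1
      · exact Finset.sum_congr rfl fun t _ => by simp; ring
      · exact Finset.sum_congr rfl fun t _ => by
          rw [show (1 : Fin 3) + 1 = 2 from rfl, show (1 : Fin 3) + 2 = 0 from rfl]; ring
    · exact Finset.sum_congr rfl fun t _ => by
        rw [show (2 : Fin 3) + 1 = 0 from rfl, show (2 : Fin 3) + 2 = 1 from rfl]; ring

/-! ### Counting exponent vectors by Fourier inversion -/

/-- `1 - |φ(t)|²`, where `φ` is the characteristic function of the law on `{0, …, q-1}` with weights
proportional to `r ^ j`. -/
noncomputable def charDeficit (q : ℕ) (r t : ℝ) : ℝ :=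
  (∑ j ∈ Finset.range q, ∑ k ∈ Finset.range q, r ^ (j + k) * (1 - Real.cos ((j - k) * t))) /
    (∑ j ∈ Finset.range q, r ^ j) ^ 2

theorem continuous_charDeficit (q : ℕ) (r : ℝ) : Continuous (charDeficit q r) := by
  unfold charDeficit
  fun_prop

theorem sum_pow_range_pos {q : ℕ} (hq : 0 < q) {r : ℝ} (hr : 0 < r) :
    0 < ∑ j ∈ Finset.range q, r ^ j :=
  Finset.sum_pos (fun j _ => pow_pos hr j) (Finset.nonempty_range_iff.2 hq.ne')

theorem integral_exp_int_mul_I (l : ℤ) :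
    ∫ t in -Real.pi..Real.pi, Complex.exp (l * Complex.I * t) =
      if l = 0 then 2 * (Real.pi : ℂ) else 0 := by
  split_ifs with h
  · simp [h]; ring
  · have hc : (l : ℂ) * Complex.I ≠ 0 := mul_ne_zero (by exact_mod_cast h) Complex.I_ne_zero
    rw [integral_exp_mul_complex hc]
    have : (l : ℂ) * Complex.I * (Real.pi : ℝ) =
        l * Complex.I * (-Real.pi : ℝ) + l * (2 * Real.pi * Complex.I) := by
      push_cast; ring
    rw [this, Complex.exp_add, Complex.exp_int_mul_two_pi_mul_I, mul_one, sub_self, zero_div]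

theorem norm_sq_sum_pow_mul_exp {q : ℕ} (hq : 0 < q) {r : ℝ} (hr : 0 < r) (t : ℝ) :
    ‖∑ j ∈ Finset.range q, (r : ℂ) ^ j * Complex.exp (j * Complex.I * t)‖ ^ 2 =
      (∑ j ∈ Finset.range q, r ^ j) ^ 2 * (1 - charDeficit q r t) := by
  have hterm : ∀ j : ℕ, (r : ℂ) ^ j * Complex.exp (j * Complex.I * t) =
      ((r ^ j * Real.cos (j * t) : ℝ) : ℂ) + ((r ^ j * Real.sin (j * t) : ℝ) : ℂ) * Complex.I := by
    intro j
    rw [show (j : ℂ) * Complex.I * t = ((j * t : ℝ) : ℂ) * Complex.I by push_cast; ring,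
      Complex.exp_mul_I]
    push_cast; ring
  rw [Finset.sum_congr rfl fun j _ => hterm j, Finset.sum_add_distrib, ← Finset.sum_mul,
    ← Complex.ofReal_sum, ← Complex.ofReal_sum, ← Complex.normSq_eq_norm_sq,
    Complex.normSq_add_mul_I]
  have hP := (sum_pow_range_pos hq hr).ne'
  rw [mul_sub, charDeficit, mul_div_cancel₀ _ (pow_ne_zero 2 hP)]
  simp only [sq, Finset.sum_mul_sum, ← Finset.sum_add_distrib, ← Finset.sum_sub_distrib, mul_one]
  refine Finset.sum_congr rfl fun j _ => Finset.sum_congr rfl fun k _ => ?_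
  rw [sub_mul, Real.cos_sub, pow_add]
  ring

/-- Follows from 1 - x ≤ e^{-x} applied to the squared modulus. -/
theorem norm_sum_pow_mul_exp_pow_le {q : ℕ} (hq : 0 < q) {r : ℝ} (hr : 0 < r) (n : ℕ) (t : ℝ) :
    ‖∑ j ∈ Finset.range q, (r : ℂ) ^ j * Complex.exp (j * Complex.I * t)‖ ^ n ≤
      (∑ j ∈ Finset.range q, r ^ j) ^ n * Real.exp (-(n * charDeficit q r t / 2)) := by
  have hP := sum_pow_range_pos hq hr
  have h1 : ‖∑ j ∈ Finset.range q, (r : ℂ) ^ j * Complex.exp (j * Complex.I * t)‖ ≤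
      (∑ j ∈ Finset.range q, r ^ j) * Real.exp (-(charDeficit q r t / 2)) := by
    refine le_of_sq_le_sq ?_ (by positivity)
    rw [norm_sq_sum_pow_mul_exp hq hr, mul_pow, ← Real.exp_nat_mul]
    refine mul_le_mul_of_nonneg_left ?_ (by positivity)
    have := Real.add_one_le_exp (-charDeficit q r t)
    rw [show ((2 : ℕ) : ℝ) * -(charDeficit q r t / 2) = -charDeficit q r t by push_cast; ring]
    linarith
  refine (pow_le_pow_left₀ (norm_nonneg _) h1 n).trans_eq ?_
  rw [mul_pow, ← Real.exp_nat_mul]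
  congr 2
  ring

/-- Local bound: the number of vectors in `{0, …, q-1}ⁿ` with coordinate sum `k`. -/
theorem card_sum_eq_mul_pow_le {q : ℕ} (hq : 0 < q) {r : ℝ} (hr : 0 < r) (n k : ℕ) :
    2 * Real.pi * (({m ∈ Fintype.piFinset fun _ : Fin n => Finset.range q |
        ∑ i, m i = k}.card : ℝ) * r ^ k) ≤
      (∑ j ∈ Finset.range q, r ^ j) ^ n *
        ∫ t in -Real.pi..Real.pi, Real.exp (-(n * charDeficit q r t / 2)) := by
  set w : ℝ → ℂ := fun t => ∑ j ∈ Finset.range q, (r : ℂ) ^ j * Complex.exp (j * Complex.I * t)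
    with hw
  have hπ : -Real.pi ≤ Real.pi := by linarith [Real.pi_pos]
  have hwcont : Continuous w := by
    simp only [hw]
    fun_prop
  have hpow : ∀ t, w t ^ n * Complex.exp (-(k * Complex.I * t)) =
      ∑ m ∈ Fintype.piFinset fun _ : Fin n => Finset.range q,
        (r : ℂ) ^ (∑ i, m i) * Complex.exp (((∑ i, m i : ℕ) - k : ℤ) * Complex.I * t) := by
    intro t
    have : w t ^ n = ∏ _i : Fin n, w t := by simp
    rw [this]
    simp only [hw, Finset.prod_univ_sum, Finset.sum_mul]
    refine Finset.sum_congr rfl fun m _ => ?_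
    rw [Finset.prod_mul_distrib, Finset.prod_pow_eq_pow_sum, ← Complex.exp_sum, mul_assoc,
      ← Complex.exp_add]
    congr 2
    simp only [← Finset.sum_mul]
    push_cast
    ring
  have hint : ∫ t in -Real.pi..Real.pi, w t ^ n * Complex.exp (-(k * Complex.I * t)) =
      ((2 * Real.pi * (({m ∈ Fintype.piFinset fun _ : Fin n => Finset.range q |
        ∑ i, m i = k}.card : ℝ) * r ^ k) : ℝ) : ℂ) := by
    simp only [hpow]
    rw [intervalIntegral.integral_finsetSum fun m _ =>
      Continuous.intervalIntegrable (by fun_prop) _ _]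
    simp only [intervalIntegral.integral_const_mul, integral_exp_int_mul_I]
    have : ∀ m : Fin n → ℕ, (r : ℂ) ^ (∑ i, m i) *
        (if ((∑ i, m i : ℕ) - k : ℤ) = 0 then 2 * (Real.pi : ℂ) else 0) =
        if ∑ i, m i = k then (r : ℂ) ^ k * (2 * Real.pi) else 0 := by
      intro m
      by_cases h : ∑ i, m i = k
      · rw [if_pos h, if_pos (by omega), h]
      · rw [if_neg h, if_neg (by omega), mul_zero]
    rw [Finset.sum_congr rfl fun m _ => this m, ← Finset.sum_filter, Finset.sum_const]
    push_cast
    rw [nsmul_eq_mul]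
    ring
  have hnonneg : 0 ≤ 2 * Real.pi * (({m ∈ Fintype.piFinset fun _ : Fin n => Finset.range q |
        ∑ i, m i = k}.card : ℝ) * r ^ k) := by positivity
  rw [← abs_of_nonneg hnonneg, ← Real.norm_eq_abs, ← Complex.norm_real, ← hint,
    ← intervalIntegral.integral_const_mul]
  refine (intervalIntegral.norm_integral_le_integral_norm hπ).trans ?_
  have hψ := continuous_charDeficit q r
  refine intervalIntegral.integral_mono_on hπ
    (Continuous.intervalIntegrable (by fun_prop) _ _)
    (Continuous.intervalIntegrable (by fun_prop) _ _) fun t _ => ?_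
  rw [norm_mul, norm_pow, show -(k * Complex.I * t) = ((-(k * t) : ℝ) : ℂ) * Complex.I by
    push_cast; ring, Complex.norm_exp_ofReal_mul_I, mul_one]
  exact norm_sum_pow_mul_exp_pow_le hq hr n t

/-- The local bound for degree k is proportional to r^(-k), so summing over k ≤ N costs only a
geometric series in r, bounded by 1/(1-r). -/
theorem card_lowDegreeExponents_le {q : ℕ} (hq : 0 < q) {r : ℝ} (hr : r ∈ Ioo (0 : ℝ) 1) (n : ℕ) :
    ((lowDegreeExponents q n).card : ℝ) ≤
      ratioFun q r ^ n / (2 * Real.pi * (1 - r)) *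
        ∫ t in -Real.pi..Real.pi, Real.exp (-(n * charDeficit q r t / 2)) := by
  obtain ⟨hr0, hr1⟩ := hr
  set P := ∑ j ∈ Finset.range q, r ^ j with hP
  have hPpos : 0 < P := sum_pow_range_pos hq hr0
  set I := ∫ t in -Real.pi..Real.pi, Real.exp (-(n * charDeficit q r t / 2)) with hI
  have hI0 : 0 ≤ I := intervalIntegral.integral_nonneg (by linarith [Real.pi_pos])
    fun t _ => (Real.exp_pos _).le
  set N := (q - 1) * n / 3 with hN
  have hcard : (lowDegreeExponents q n).card ≤ ∑ k ∈ Finset.range (N + 1),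
      {m ∈ Fintype.piFinset fun _ : Fin n => Finset.range q | ∑ i, m i = k}.card := by
    rw [Finset.card_eq_sum_card_fiberwise (f := fun m => ∑ i, m i) (t := Finset.range (N + 1))]
    · refine Finset.sum_le_sum fun k _ => Finset.card_le_card fun m hm => ?_
      simp only [lowDegreeExponents, Finset.mem_filter] at hm ⊢
      exact ⟨hm.1.1, hm.2⟩
    · intro m hm
      have := (Finset.mem_filter.1 hm).2
      simp only [Finset.coe_range, Set.mem_Iio]
      omega
  have hterm : ∀ k ∈ Finset.range (N + 1),
      ({m ∈ Fintype.piFinset fun _ : Fin n => Finset.range q | ∑ i, m i = k}.card : ℝ) ≤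
        P ^ n * I / (2 * Real.pi * r ^ N) * r ^ (N - k) := by
    intro k hk
    have hkN : k ≤ N := by have := Finset.mem_range.1 hk; omega
    have h := card_sum_eq_mul_pow_le hq hr0 n k
    rw [div_mul_eq_mul_div, le_div_iff₀ (by have := Real.pi_pos; positivity)]
    have hNk : r ^ N = r ^ k * r ^ (N - k) := by rw [← pow_add]; congr 1; omega
    rw [hNk]
    have := mul_le_mul_of_nonneg_right h (pow_nonneg hr0.le (N - k))
    linarith
  have hgeom : ∑ k ∈ Finset.range (N + 1), r ^ (N - k) ≤ 1 / (1 - r) := by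
    rw [Finset.sum_flip (fun j => r ^ j), le_div_iff₀ (by linarith), geom_sum_mul_neg]
    linarith [pow_pos hr0 (N + 1)]
  -- Rounding (q-1)n/3 down to N only helps: since r < 1, r^N is at least r^((q-1)n/3).
  have hratio : P ^ n / r ^ N ≤ ratioFun q r ^ n := by
    rw [ratioFun, div_pow]
    refine div_le_div_of_nonneg_left (by positivity) (by positivity) ?_
    rw [← Real.rpow_natCast, ← Real.rpow_mul hr0.le, ← Real.rpow_natCast]
    refine Real.rpow_le_rpow_of_exponent_ge hr0 hr1.le ?_
    have h3 : ((3 * N : ℕ) : ℝ) ≤ (((q - 1) * n : ℕ) : ℝ) := by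
      exact_mod_cast Nat.mul_div_le _ _
    push_cast [Nat.cast_sub (show 1 ≤ q from hq)] at h3
    linarith
  have h1r : 0 < 1 - r := by linarith
  calc ((lowDegreeExponents q n).card : ℝ)
      ≤ ∑ k ∈ Finset.range (N + 1),
        ({m ∈ Fintype.piFinset fun _ : Fin n => Finset.range q | ∑ i, m i = k}.card : ℝ) := by
        exact_mod_cast hcard
    _ ≤ ∑ k ∈ Finset.range (N + 1), P ^ n * I / (2 * Real.pi * r ^ N) * r ^ (N - k) :=
        Finset.sum_le_sum hterm
    _ ≤ P ^ n * I / (2 * Real.pi * r ^ N) * (1 / (1 - r)) := by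
        rw [← Finset.mul_sum]
        exact mul_le_mul_of_nonneg_left hgeom (by have := Real.pi_pos; positivity)
    _ = P ^ n / r ^ N * (I / (2 * Real.pi * (1 - r))) := by
        have := Real.pi_pos
        field_simp
    _ ≤ ratioFun q r ^ n * (I / (2 * Real.pi * (1 - r))) :=
        mul_le_mul_of_nonneg_right hratio (by have := Real.pi_pos; positivity)
    _ = _ := by ring

/-! ### Laplace asymptotics -/

/-- The variance of the law on `{0, …, q-1}` with weights proportional to `r ^ j`. -/
noncomputable def tiltedVariance (q : ℕ) (r : ℝ) : ℝ :=
  (∑ j ∈ Finset.range q, ∑ k ∈ Finset.range q, r ^ (j + k) * (((j : ℝ) - k) ^ 2 / 2)) /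
    (∑ j ∈ Finset.range q, r ^ j) ^ 2

theorem tiltedVariance_pos {q : ℕ} (hq : 2 ≤ q) {r : ℝ} (hr : 0 < r) : 0 < tiltedVariance q r := by
  have hP := sum_pow_range_pos (by omega : 0 < q) hr
  refine div_pos ?_ (by positivity)
  refine Finset.sum_pos' (fun j _ => Finset.sum_nonneg fun k _ => by positivity)
    ⟨0, Finset.mem_range.2 (by omega), Finset.sum_pos' (fun k _ => by positivity)
      ⟨1, Finset.mem_range.2 (by omega), by norm_num; positivity⟩⟩

/-- The single pair j = 0, k = 1 already contributes r(1 - cos t), which is quadratic from below on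
[-π, π]. This supplies the Gaussian majorant for dominated convergence. -/
theorem exists_mul_sq_le_charDeficit {q : ℕ} (hq : 2 ≤ q) {r : ℝ} (hr : 0 < r) :
    ∃ c > 0, ∀ t : ℝ, |t| ≤ Real.pi → c * t ^ 2 ≤ charDeficit q r t := by
  have hP := sum_pow_range_pos (by omega : 0 < q) hr
  refine ⟨r * (2 / Real.pi ^ 2) / (∑ j ∈ Finset.range q, r ^ j) ^ 2,
    by have := Real.pi_pos; positivity, fun t ht => ?_⟩
  rw [charDeficit, div_mul_eq_mul_div]
  refine div_le_div_of_nonneg_right ?_ (by positivity)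
  have hnn : ∀ j k : ℕ, 0 ≤ r ^ (j + k) * (1 - Real.cos (((j : ℝ) - k) * t)) := fun j k =>
    mul_nonneg (by positivity) (sub_nonneg.2 (Real.cos_le_one _))
  calc r * (2 / Real.pi ^ 2) * t ^ 2 ≤ r * (1 - Real.cos t) := by
        rw [mul_assoc]
        have := Real.cos_le_one_sub_mul_cos_sq ht
        exact mul_le_mul_of_nonneg_left (by linarith) hr.le
    _ = r ^ (0 + 1) * (1 - Real.cos ((((0 : ℕ) : ℝ) - (1 : ℕ)) * t)) := by simp
    _ ≤ ∑ k ∈ Finset.range q, r ^ (0 + k) * (1 - Real.cos ((((0 : ℕ) : ℝ) - k) * t)) :=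
        Finset.single_le_sum (f := fun k : ℕ =>
          r ^ (0 + k) * (1 - Real.cos ((((0 : ℕ) : ℝ) - k) * t)))
          (fun k _ => hnn 0 k) (Finset.mem_range.2 (by omega))
    _ ≤ _ := Finset.single_le_sum (f := fun j : ℕ => ∑ k ∈ Finset.range q,
          r ^ (j + k) * (1 - Real.cos (((j : ℝ) - k) * t)))
          (fun j _ => Finset.sum_nonneg fun k _ => hnn j k) (Finset.mem_range.2 (by omega))

theorem tendsto_mul_one_sub_cos_div_sqrt (a : ℝ) :
    Tendsto (fun n : ℕ => (n : ℝ) * (1 - Real.cos (a / √n))) atTop (𝓝 (a ^ 2 / 2)) := by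
  rw [tendsto_iff_norm_sub_tendsto_zero]
  have hlim : Tendsto (fun n : ℕ => |a| ^ 4 * (5 / 96) / (n : ℝ)) atTop (𝓝 0) :=
    tendsto_const_div_atTop_nhds_zero_nat _
  refine squeeze_zero' (Eventually.of_forall fun n => norm_nonneg _) ?_ hlim
  have hev : ∀ᶠ n : ℕ in atTop, a ^ 2 ≤ n :=
    tendsto_natCast_atTop_atTop.eventually_ge_atTop _
  filter_upwards [hev, eventually_gt_atTop 0] with n hn hn0
  have hn0' : (0 : ℝ) < n := by exact_mod_cast hn0
  have hs : 0 < √(n : ℝ) := Real.sqrt_pos.2 hn0'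
  have hs2 : √(n : ℝ) ^ 2 = n := Real.sq_sqrt hn0'.le
  have habs : |a / √n| ≤ 1 := by
    rw [abs_div, abs_of_pos hs, div_le_one hs]
    exact Real.abs_le_sqrt hn
  have hb := Real.cos_bound habs
  have h1 : (n : ℝ) * (1 - Real.cos (a / √n)) - a ^ 2 / 2 =
      -(n * (Real.cos (a / √n) - (1 - (a / √n) ^ 2 / 2))) := by
    rw [div_pow, hs2]
    field_simp
    ring
  rw [h1, norm_neg, norm_mul, Real.norm_of_nonneg hn0'.le, Real.norm_eq_abs]
  refine (mul_le_mul_of_nonneg_left hb hn0'.le).trans_eq ?_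
  rw [abs_div, abs_of_pos hs, div_pow, show √(n : ℝ) ^ 4 = (n : ℝ) ^ 2 by
    rw [← congrArg (· ^ 2) hs2]; ring]
  field_simp

theorem tendsto_mul_charDeficit_div_sqrt (q : ℕ) (r u : ℝ) :
    Tendsto (fun n : ℕ => (n : ℝ) * charDeficit q r (u / √n)) atTop
      (𝓝 (tiltedVariance q r * u ^ 2)) := by
  have h : Tendsto (fun n : ℕ => (∑ j ∈ Finset.range q, ∑ k ∈ Finset.range q,
      r ^ (j + k) * ((n : ℝ) * (1 - Real.cos ((((j : ℝ) - k) * u) / √n)))) /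
        (∑ j ∈ Finset.range q, r ^ j) ^ 2) atTop
      (𝓝 ((∑ j ∈ Finset.range q, ∑ k ∈ Finset.range q,
        r ^ (j + k) * ((((j : ℝ) - k) * u) ^ 2 / 2)) / (∑ j ∈ Finset.range q, r ^ j) ^ 2)) :=
    (tendsto_finsetSum _ fun j _ => tendsto_finsetSum _ fun k _ =>
      (tendsto_mul_one_sub_cos_div_sqrt _).const_mul _).div_const _
  convert h using 2 with n
  · rw [charDeficit, ← mul_div_assoc]
    congr 1
    simp only [Finset.mul_sum]
    refine Finset.sum_congr rfl fun j _ => Finset.sum_congr rfl fun k _ => ?_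
    rw [mul_div_assoc]
    ring
  · rw [tiltedVariance, div_mul_eq_mul_div]
    congr 1
    simp only [Finset.sum_mul]
    refine Finset.sum_congr rfl fun j _ => Finset.sum_congr rfl fun k _ => ?_
    ring

/-- Laplace asymptotics of the integral bounding the local probabilities. -/
theorem tendsto_sqrt_mul_integral_exp_charDeficit {q : ℕ} (hq : 2 ≤ q) {r : ℝ} (hr : 0 < r) :
    Tendsto (fun n : ℕ => √(n : ℝ) *
      ∫ t in -Real.pi..Real.pi, Real.exp (-(n * charDeficit q r t / 2))) atTop
      (𝓝 √(2 * Real.pi / tiltedVariance q r)) := by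
  have hV := tiltedVariance_pos hq hr
  obtain ⟨c, hc, hψ⟩ := exists_mul_sq_le_charDeficit hq hr
  have hcont := continuous_charDeficit q r
  -- The integrand after the substitution t = u/√n, extended by zero to the whole line.
  set F : ℕ → ℝ → ℝ := fun n => (Ioc (-Real.pi * √n) (Real.pi * √n)).indicator
    fun u => Real.exp (-(n * charDeficit q r (u / √n) / 2)) with hF
  have hgauss : ∫ u, Real.exp (-(tiltedVariance q r / 2) * u ^ 2) =
      √(2 * Real.pi / tiltedVariance q r) := by
    rw [integral_gaussian]
    congr 1
    field_simp
  rw [← hgauss]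
  have hlim : Tendsto (fun n => ∫ u, F n u) atTop
      (𝓝 (∫ u, Real.exp (-(tiltedVariance q r / 2) * u ^ 2))) := by
    refine MeasureTheory.tendsto_integral_filter_of_dominated_convergence
      (fun u => Real.exp (-(c / 2) * u ^ 2)) ?_ ?_ (integrable_exp_neg_mul_sq (by positivity)) ?_
    · refine Eventually.of_forall fun n => ?_
      refine (Measurable.indicator ?_ measurableSet_Ioc).aestronglyMeasurable
      exact Continuous.measurable (by fun_prop)
    · filter_upwards [eventually_gt_atTop 0] with n hn0
      refine Eventually.of_forall fun u => ?_
      have hn0' : (0 : ℝ) < n := by exact_mod_cast hn0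
      have hs : 0 < √(n : ℝ) := Real.sqrt_pos.2 hn0'
      by_cases hu : u ∈ Ioc (-Real.pi * √n) (Real.pi * √n)
      · simp only [hF, indicator_of_mem hu]
        rw [Real.norm_of_nonneg (Real.exp_pos _).le]
        refine Real.exp_le_exp.2 ?_
        have habs : |u / √n| ≤ Real.pi := by
          rw [abs_div, abs_of_pos hs, div_le_iff₀ hs, abs_le]
          exact ⟨by linarith [hu.1], hu.2⟩
        have h := mul_le_mul_of_nonneg_left (hψ _ habs) hn0'.le
        have h2 : (n : ℝ) * (c * (u / √n) ^ 2) = c * u ^ 2 := by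
          rw [div_pow, Real.sq_sqrt hn0'.le]
          field_simp
        rw [h2] at h
        linarith
      · simp only [hF, indicator_of_notMem hu, norm_zero]
        exact (Real.exp_pos _).le
    · refine Eventually.of_forall fun u => ?_
      have h1 : Tendsto (fun n : ℕ => Real.exp (-(n * charDeficit q r (u / √n) / 2))) atTop
          (𝓝 (Real.exp (-(tiltedVariance q r / 2) * u ^ 2))) := by
        refine (Real.continuous_exp.tendsto _).comp ?_
        have := ((tendsto_mul_charDeficit_div_sqrt q r u).div_const 2).neg
        rwa [show -(tiltedVariance q r * u ^ 2 / 2) = -(tiltedVariance q r / 2) * u ^ 2 by ring]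
          at this
      refine h1.congr' ?_
      have hev : Tendsto (fun n : ℕ => Real.pi * √(n : ℝ)) atTop atTop :=
        (Real.tendsto_sqrt_atTop.comp tendsto_natCast_atTop_atTop).const_mul_atTop Real.pi_pos
      filter_upwards [hev.eventually_gt_atTop |u|] with n hn
      have hu : u ∈ Ioc (-Real.pi * √n) (Real.pi * √n) := by
        obtain ⟨h1, h2⟩ := abs_lt.1 hn
        exact ⟨by linarith, h2.le⟩
      simp only [hF, indicator_of_mem hu]
  refine hlim.congr' ?_
  filter_upwards [eventually_gt_atTop 0] with n hn0
  have hn0' : (0 : ℝ) < n := by exact_mod_cast hn0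
  have hs : 0 < √(n : ℝ) := Real.sqrt_pos.2 hn0'
  have hle : -Real.pi * √n ≤ Real.pi * √n := by
    have := mul_pos Real.pi_pos hs
    linarith
  simp only [hF]
  rw [MeasureTheory.integral_indicator measurableSet_Ioc, ← intervalIntegral.integral_of_le hle,
    intervalIntegral.integral_comp_div (fun t => Real.exp (-(n * charDeficit q r t / 2))) hs.ne',
    mul_div_cancel_right₀ _ hs.ne', mul_div_cancel_right₀ _ hs.ne', smul_eq_mul]

/-! ### The minimum of f and its second derivative -/

theorem ratioFun_eq_sum_rpow (q : ℕ) {x : ℝ} (hx : 0 < x) :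
    ratioFun q x = ∑ i ∈ Finset.range q, x ^ ((i : ℝ) - ((q : ℝ) - 1) / 3) := by
  rw [ratioFun, Finset.sum_div]
  refine Finset.sum_congr rfl fun i _ => ?_
  rw [Real.rpow_sub hx, Real.rpow_natCast]

theorem hasDerivAt_sum_mul_rpow {ι : Type*} (S : Finset ι) (c e : ι → ℝ) {x : ℝ} (hx : 0 < x) :
    HasDerivAt (fun x : ℝ => ∑ i ∈ S, c i * x ^ e i) (∑ i ∈ S, c i * e i * x ^ (e i - 1)) x := by
  refine HasDerivAt.fun_sum fun i _ => ?_
  rw [mul_assoc]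
  exact (Real.hasDerivAt_rpow_const (Or.inl hx.ne')).const_mul _

theorem deriv_ratioFun (q : ℕ) {x : ℝ} (hx : 0 < x) :
    deriv (ratioFun q) x = ∑ i ∈ Finset.range q,
      ((i : ℝ) - ((q : ℝ) - 1) / 3) * x ^ ((i : ℝ) - ((q : ℝ) - 1) / 3 - 1) := by
  have h := hasDerivAt_sum_mul_rpow (Finset.range q) (fun _ => 1)
    (fun i : ℕ => (i : ℝ) - ((q : ℝ) - 1) / 3) hx
  have heq : ratioFun q =ᶠ[𝓝 x] fun x : ℝ => ∑ i ∈ Finset.range q,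
      1 * x ^ ((i : ℝ) - ((q : ℝ) - 1) / 3) := by
    filter_upwards [lt_mem_nhds hx] with y hy
    simp [ratioFun_eq_sum_rpow q hy]
  rw [heq.deriv_eq, h.deriv]
  simp

theorem deriv_deriv_ratioFun (q : ℕ) {x : ℝ} (hx : 0 < x) :
    deriv (deriv (ratioFun q)) x = ∑ i ∈ Finset.range q,
      ((i : ℝ) - ((q : ℝ) - 1) / 3) * ((i : ℝ) - ((q : ℝ) - 1) / 3 - 1) *
        x ^ ((i : ℝ) - ((q : ℝ) - 1) / 3 - 1 - 1) := by
  have h := hasDerivAt_sum_mul_rpow (Finset.range q) (fun i : ℕ => (i : ℝ) - ((q : ℝ) - 1) / 3)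
    (fun i : ℕ => (i : ℝ) - ((q : ℝ) - 1) / 3 - 1) hx
  have heq : deriv (ratioFun q) =ᶠ[𝓝 x] fun x : ℝ => ∑ i ∈ Finset.range q,
      ((i : ℝ) - ((q : ℝ) - 1) / 3) * x ^ ((i : ℝ) - ((q : ℝ) - 1) / 3 - 1) := by
    filter_upwards [lt_mem_nhds hx] with y hy using deriv_ratioFun q hy
  rw [heq.deriv_eq, h.deriv]

theorem ratioFun_one (q : ℕ) : ratioFun q 1 = q := by simp [ratioFun]

theorem sum_sub_third_pos {q : ℕ} (hq : 2 ≤ q) :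
    0 < ∑ i ∈ Finset.range q, ((i : ℝ) - ((q : ℝ) - 1) / 3) := by
  have h2 : (2 : ℝ) ≤ q := by exact_mod_cast hq
  have h : (∑ i ∈ Finset.range q, (i : ℝ)) * 2 = q * (q - 1) := by
    have := Finset.sum_range_id_mul_two q
    rw [← Nat.cast_sum, ← Nat.cast_ofNat (n := 2), ← Nat.cast_mul, this]
    push_cast [Nat.cast_sub (show 1 ≤ q by omega)]
    ring
  rw [Finset.sum_sub_distrib, Finset.sum_const, Finset.card_range, nsmul_eq_mul]
  nlinarith

theorem deriv_ratioFun_one_pos {q : ℕ} (hq : 2 ≤ q) : 0 < deriv (ratioFun q) 1 := by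
  rw [deriv_ratioFun q one_pos]
  simpa using sum_sub_third_pos hq

/-- As a function of log x, f is a sum of exponentials, each above its tangent line at 0; the summed
slope is positive. -/
theorem ratioFun_one_le {q : ℕ} (hq : 2 ≤ q) {x : ℝ} (hx : 1 ≤ x) :
    ratioFun q 1 ≤ ratioFun q x := by
  have hx0 : 0 < x := by linarith
  rw [ratioFun_one, ratioFun_eq_sum_rpow q hx0]
  have h : ∀ i ∈ Finset.range q, Real.log x * ((i : ℝ) - ((q : ℝ) - 1) / 3) + 1 ≤
      x ^ ((i : ℝ) - ((q : ℝ) - 1) / 3) := fun i _ => by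
    rw [Real.rpow_def_of_pos hx0]
    exact Real.add_one_le_exp _
  refine le_trans ?_ (Finset.sum_le_sum h)
  rw [Finset.sum_add_distrib, ← Finset.mul_sum]
  have := mul_nonneg (Real.log_nonneg hx) (sum_sub_third_pos hq).le
  simp only [Finset.sum_const, Finset.card_range, nsmul_eq_mul, mul_one]
  linarith

theorem continuousOn_ratioFun (q : ℕ) : ContinuousOn (ratioFun q) (Ioi 0) := by
  unfold ratioFun
  refine ContinuousOn.div (by fun_prop) ?_ fun x hx => (Real.rpow_pos_of_pos hx _).ne'
  exact fun x hx => (Real.continuousAt_rpow_const _ _ (Or.inl (ne_of_gt hx))).continuousWithinAt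

theorem deriv_ratioFun_eq_zero {q : ℕ} {r : ℝ} (hr : 0 < r)
    (hmin : IsMinOn (ratioFun q) (Ioi 0) r) : deriv (ratioFun q) r = 0 :=
  (hmin.isLocalMin (Ioi_mem_nhds hr)).deriv_eq_zero

theorem ratioFun_lt {q : ℕ} (hq : 2 ≤ q) {r : ℝ} (hmin : IsMinOn (ratioFun q) (Ioi 0) r) :
    ratioFun q r < q := by
  rw [← ratioFun_one q]
  refine lt_of_le_of_ne (hmin (mem_Ioi.2 one_pos)) fun h => ?_
  have hmin1 : IsMinOn (ratioFun q) (Ioi 0) 1 := fun x hx => by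
    simpa [← h] using hmin hx
  exact (deriv_ratioFun_one_pos hq).ne' (deriv_ratioFun_eq_zero one_pos hmin1)

theorem exists_isMinOn_ratioFun {q : ℕ} (hq : 2 ≤ q) :
    ∃ r ∈ Ioo (0 : ℝ) 1, IsMinOn (ratioFun q) (Ioi 0) r := by
  have h2 : (2 : ℝ) ≤ q := by exact_mod_cast hq
  set s : ℝ := ((q : ℝ) - 1) / 3 with hs
  have hs0 : 0 < s := by rw [hs]; linarith
  -- Chosen so that δ^(-s) = q = f(1): for x < δ the i = 0 term alone is at least f(1), which
  -- confines the search to [δ, 1].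
  set δ : ℝ := (q : ℝ) ^ (-(1 / s)) with hδ
  have hδ0 : 0 < δ := Real.rpow_pos_of_pos (by linarith) _
  have hδ1 : δ ≤ 1 := Real.rpow_le_one_of_one_le_of_nonpos (by linarith)
    (by have : 0 < 1 / s := by positivity
        linarith)
  obtain ⟨r, hr, hrmin⟩ := isCompact_Icc.exists_isMinOn (nonempty_Icc.2 hδ1)
    ((continuousOn_ratioFun q).mono fun x hx => lt_of_lt_of_le hδ0 hx.1)
  have hr0 : 0 < r := hδ0.trans_le hr.1
  have hr1 : ratioFun q r ≤ ratioFun q 1 := hrmin (right_mem_Icc.2 hδ1)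
  have hmin : IsMinOn (ratioFun q) (Ioi 0) r := by
    intro x hx
    rcases le_or_gt 1 x with h1 | h1
    · exact hr1.trans (ratioFun_one_le hq h1)
    rcases le_or_gt δ x with h | h
    · exact hrmin ⟨h, h1.le⟩
    · refine hr1.trans ?_
      have hx0 : 0 < x := hx
      have hδs : δ ^ (-s) = q := by
        rw [hδ, ← Real.rpow_mul (by linarith)]
        field_simp
        simp
      have hterm : (q : ℝ) ≤ x ^ (((0 : ℕ) : ℝ) - s) := by
        rw [← hδs, Nat.cast_zero, zero_sub]
        exact Real.rpow_le_rpow_of_nonpos hx0 h.le (by linarith)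
      rw [ratioFun_one, ratioFun_eq_sum_rpow q hx0]
      exact hterm.trans (Finset.single_le_sum
        (f := fun i : ℕ => x ^ ((i : ℝ) - s)) (fun i _ => (Real.rpow_pos_of_pos hx0 _).le)
        (Finset.mem_range.2 (by omega)))
  refine ⟨r, ⟨hr0, lt_of_le_of_ne hr.2 ?_⟩, hmin⟩
  rintro rfl
  exact (deriv_ratioFun_one_pos hq).ne' (deriv_ratioFun_eq_zero one_pos hmin)

theorem ratioFun_pos {q : ℕ} (hq : 0 < q) {r : ℝ} (hr : 0 < r) : 0 < ratioFun q r :=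
  div_pos (sum_pow_range_pos hq hr) (Real.rpow_pos_of_pos hr _)

/-- At a minimum of `ratioFun`, its logarithmic second derivative is the tilted variance. -/
theorem sq_mul_deriv_deriv_ratioFun {q : ℕ} (hq : 0 < q) {r : ℝ} (hr : 0 < r)
    (hmin : IsMinOn (ratioFun q) (Ioi 0) r) :
    r ^ 2 * deriv (deriv (ratioFun q)) r = ratioFun q r * tiltedVariance q r := by
  have hf := ratioFun_pos hq hr
  set s : ℝ := ((q : ℝ) - 1) / 3 with hs
  set w : ℕ → ℝ := fun i => r ^ ((i : ℝ) - s) with hw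
  have hfw : ratioFun q r = ∑ i ∈ Finset.range q, w i := ratioFun_eq_sum_rpow q hr
  have h1 : ∑ i ∈ Finset.range q, ((i : ℝ) - s) * w i = 0 := by
    have h := deriv_ratioFun_eq_zero hr hmin
    rw [deriv_ratioFun q hr] at h
    rw [← zero_mul r, ← h, Finset.sum_mul]
    refine Finset.sum_congr rfl fun i _ => ?_
    rw [Real.rpow_sub_one hr.ne']
    simp only [hw, ← hs]
    field_simp
  have h2 : r ^ 2 * deriv (deriv (ratioFun q)) r =
      ∑ i ∈ Finset.range q, ((i : ℝ) - s) ^ 2 * w i := by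
    -- The factor (i-s)(i-s-1) differs from (i-s)² by i-s, whose weighted sum vanishes by `h1`.
    rw [deriv_deriv_ratioFun q hr, ← sub_zero (∑ i ∈ Finset.range q, ((i : ℝ) - s) ^ 2 * w i),
      ← h1, ← Finset.sum_sub_distrib, Finset.mul_sum]
    refine Finset.sum_congr rfl fun i _ => ?_
    rw [Real.rpow_sub_one hr.ne', Real.rpow_sub_one hr.ne']
    simp only [hw, ← hs]
    field_simp
  set R : ℝ := r ^ s with hR
  have hR0 : 0 < R := Real.rpow_pos_of_pos hr _
  have hpow : ∀ i : ℕ, r ^ i = R * w i := fun i => by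
    rw [hR, hw, ← Real.rpow_add hr, ← Real.rpow_natCast]
    congr 1
    ring
  have hV : tiltedVariance q r = (∑ j ∈ Finset.range q, ∑ k ∈ Finset.range q,
      w j * w k * (((j : ℝ) - k) ^ 2 / 2)) / (∑ j ∈ Finset.range q, w j) ^ 2 := by
    have hnum : ∑ j ∈ Finset.range q, ∑ k ∈ Finset.range q,
        r ^ (j + k) * (((j : ℝ) - k) ^ 2 / 2) = R ^ 2 * ∑ j ∈ Finset.range q,
          ∑ k ∈ Finset.range q, w j * w k * (((j : ℝ) - k) ^ 2 / 2) := by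
      simp only [Finset.mul_sum]
      refine Finset.sum_congr rfl fun j _ => Finset.sum_congr rfl fun k _ => ?_
      rw [pow_add, hpow, hpow]
      ring
    rw [tiltedVariance, hnum, Finset.sum_congr rfl fun j _ => hpow j, ← Finset.mul_sum, mul_pow,
      mul_div_mul_left _ _ (pow_ne_zero 2 hR0.ne')]
  have h3 : ∑ j ∈ Finset.range q, ∑ k ∈ Finset.range q, w j * w k * (((j : ℝ) - k) ^ 2 / 2) =
      (∑ j ∈ Finset.range q, w j) * ∑ i ∈ Finset.range q, ((i : ℝ) - s) ^ 2 * w i := by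
    -- Centring at the mean s; the cross term sums to the square of the first centred moment, which
    -- is zero.
    have hexp : ∀ j k : ℕ, w j * w k * (((j : ℝ) - k) ^ 2 / 2) =
        (((j : ℝ) - s) ^ 2 * w j * w k + w j * (((k : ℝ) - s) ^ 2 * w k)) / 2 -
          (((j : ℝ) - s) * w j) * (((k : ℝ) - s) * w k) := fun j k => by ring
    simp only [hexp, Finset.sum_sub_distrib, ← Finset.sum_div, Finset.sum_add_distrib,
      ← Finset.mul_sum, ← Finset.sum_mul, h1]
    ring
  rw [h2, hV, h3, hfw]
  rw [hfw] at hf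
  field_simp

theorem deriv_deriv_ratioFun_pos {q : ℕ} (hq : 2 ≤ q) {r : ℝ} (hr : 0 < r)
    (hmin : IsMinOn (ratioFun q) (Ioi 0) r) : 0 < deriv (deriv (ratioFun q)) r := by
  have h := sq_mul_deriv_deriv_ratioFun (by omega) hr hmin
  have := mul_pos (ratioFun_pos (by omega : 0 < q) hr) (tiltedVariance_pos hq hr)
  rw [← h] at this
  exact pos_of_mul_pos_right this (by positivity)

/-! ### Assembly of the bounds -/

theorem mainTheorem2 {F : Type*} [Field F] [Fintype F] (q : ℕ) (hq : Fintype.card F = q) :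
    (∃ r ∈ Ioo (0 : ℝ) 1, IsMinOn (ratioFun q) (Ioi 0) r) ∧
    ∀ r ∈ Ioo (0 : ℝ) 1, IsMinOn (ratioFun q) (Ioi 0) r →
      0 < deriv (deriv (ratioFun q)) r ∧
      ratioFun q r < q ∧
      (∃ ε : ℕ → ℝ, Tendsto ε atTop (𝓝 0) ∧
        ∀ n : ℕ, 1 ≤ n → ∀ α β γ : F, α + β + γ = 0 → γ ≠ 0 →
          ∀ A : Finset (Fin n → F), OnlyTrivialSolutions α β γ A →
            (A.card : ℝ) ≤
              3 / ((1 - r) * r) * √(ratioFun q r / deriv (deriv (ratioFun q)) r) *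
                (ratioFun q r ^ n / √(2 * Real.pi * n)) * (1 + ε n)) ∧
      (∃ C : ℝ, ∀ n : ℕ, 1 ≤ n → ∀ α β γ : F, α + β + γ = 0 → γ ≠ 0 →
          ∀ A : Finset (Fin n → F), OnlyTrivialSolutions α β γ A →
            (A.card : ℝ) ≤ C * (ratioFun q r ^ n / √n)) := by
  have hq2 : 2 ≤ q := hq ▸ Fintype.one_lt_card
  refine ⟨exists_isMinOn_ratioFun hq2, fun r hr hmin => ?_⟩
  have hr0 : 0 < r := hr.1
  have h1r : 0 < 1 - r := by linarith [hr.2]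
  have hf : 0 < ratioFun q r := ratioFun_pos (by omega) hr0
  have hf2 : 0 < deriv (deriv (ratioFun q)) r := deriv_deriv_ratioFun_pos hq2 hr0 hmin
  have hV : 0 < tiltedVariance q r := tiltedVariance_pos hq2 hr0
  have hσ : 0 < √(tiltedVariance q r) := Real.sqrt_pos.2 hV
  have h2π : 0 < √(2 * Real.pi) := Real.sqrt_pos.2 (by have := Real.pi_pos; positivity)
  have hroot : √(ratioFun q r / deriv (deriv (ratioFun q)) r) = r / √(tiltedVariance q r) := by
    rw [show ratioFun q r / deriv (deriv (ratioFun q)) r = r ^ 2 / tiltedVariance q r by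
      rw [div_eq_div_iff hf2.ne' hV.ne']
      exact (sq_mul_deriv_deriv_ratioFun (by omega) hr0 hmin).symm,
      Real.sqrt_div (sq_nonneg r), Real.sqrt_sq hr0.le]
  set I : ℕ → ℝ := fun n =>
    ∫ t in -Real.pi..Real.pi, Real.exp (-(n * charDeficit q r t / 2)) with hI
  -- The relative error of the Laplace asymptotics, built from q, r, n alone and hence uniform in A,
  -- α, β, γ.
  set ε : ℕ → ℝ := fun n =>
    √(n : ℝ) * I n * (√(tiltedVariance q r) / √(2 * Real.pi)) - 1 with hε
  have hlim : Tendsto ε atTop (𝓝 0) := by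
    have h := ((tendsto_sqrt_mul_integral_exp_charDeficit hq2 hr0).mul_const
      (√(tiltedVariance q r) / √(2 * Real.pi))).sub_const 1
    rwa [Real.sqrt_div (by have := Real.pi_pos; positivity),
      div_mul_div_cancel₀ hσ.ne', div_self h2π.ne', sub_self] at h
  have hbound : ∀ n : ℕ, 1 ≤ n → ∀ α β γ : F, α + β + γ = 0 → γ ≠ 0 →
      ∀ A : Finset (Fin n → F), OnlyTrivialSolutions α β γ A →
        (A.card : ℝ) ≤
          3 / ((1 - r) * r) * √(ratioFun q r / deriv (deriv (ratioFun q)) r) *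
            (ratioFun q r ^ n / √(2 * Real.pi * n)) * (1 + ε n) := by
    intro n hn α β γ hsum _ A hA
    have hs : 0 < √(n : ℝ) := Real.sqrt_pos.2 (by exact_mod_cast hn)
    have h1 : (A.card : ℝ) ≤ 3 * ((lowDegreeExponents q n).card : ℝ) := by
      exact_mod_cast hq ▸ card_le_three_mul_card_lowDegreeExponents hsum hA
    refine h1.trans ((mul_le_mul_of_nonneg_left
      (card_lowDegreeExponents_le (by omega) hr n) zero_le_three).trans_eq ?_)
    have h2 : 2 * Real.pi = √(2 * Real.pi) * √(2 * Real.pi) :=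
      (Real.mul_self_sqrt (by have := Real.pi_pos; positivity)).symm
    rw [hroot, Real.sqrt_mul (by have := Real.pi_pos; positivity)]
    change 3 * (ratioFun q r ^ n / (2 * Real.pi * (1 - r)) * I n) = _
    rw [show 2 * Real.pi * (1 - r) = √(2 * Real.pi) * √(2 * Real.pi) * (1 - r) by rw [← h2]]
    simp only [hε]
    field_simp
    ring
  refine ⟨hf2, ratioFun_lt hq2 hmin, ⟨ε, hlim, hbound⟩, ?_⟩
  obtain ⟨B, hB⟩ := hlim.bddAbove_range
  refine ⟨3 / ((1 - r) * r) * √(ratioFun q r / deriv (deriv (ratioFun q)) r) / √(2 * Real.pi) *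
    (1 + B), fun n hn α β γ hsum hγ A hA => (hbound n hn α β γ hsum hγ A hA).trans ?_⟩
  have hs : 0 < √(n : ℝ) := Real.sqrt_pos.2 (by exact_mod_cast hn)
  have hεB : 1 + ε n ≤ 1 + B := add_le_add_right (hB ⟨n, rfl⟩) 1
  refine (mul_le_mul_of_nonneg_left hεB (by positivity)).trans_eq ?_
  rw [Real.sqrt_mul (by have := Real.pi_pos; positivity)]
  field_simp
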